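/- Let $d\ge 1$. Let $S^d\subset\mathbb R^{d+1}$ be the unit sphere, let $\chi\in[0,\pi]$ be the angle of a point of $S^d$ from the north pole, and equip $\mathbb R\times S^d$ (time coordinate $T$, time orientation by increasing $T$) with the Lorentzian metric $dT^2-d\omega_d^2=dT^2-d\chi^2-\sin^2\chi\,d\omega_{d-1}^2$. Compactified $(d+1)$-dimensional Minkowski space is $\tilde M=\{|T|\le\pi-\chi\}\subset\mathbb R\times S^d$. Minkowski space $M=\mathbb M^{(1,d)}$ is embedded in it by $t-r=\tan P$, $t+r=\tan Q$, $T=Q+P$, $\chi=Q-P$ (angular variables unchanged). Let $\mathcal I^\pm=\{T=\pm(\pi-\chi),\ 0<\chi<\pi\}$ and let $i^0$ be the point $T=0$, $\chi=\pi$. All curves below are curves in $\tilde M$. Let $I^+(a)$ (respectively $J^+(a)$) be the set of points of $\tilde M$ that are reached from $a$ by a smooth future-directed timelike (respectively causal) curve, where $a\in J^+(a)$ by convention, and let $J^-(a)=\{b\in\tilde M: a\in J^+(b)\}$. Let $p\in\mathcal I^-$. Then there is a unique point $q\in\mathcal I^+$ that is connected to $p$ by a future-directed null geodesic from $p$ which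 enters $M$; a future-directed null geodesic from $p$ to a point of $\mathcal I^+$ enters $M$ if and only if it does not pass through $i^0$. Moreover $q\in\partial J^+(p)$ (boundary in $\tilde M$), and $$I^+(p)\cap\mathcal I^+=\mathcal I^+\setminus\bigl(J^-(q)\cap\mathcal I^+\bigr).$$ The points of $\mathcal I^+$ that cannot be connected to $p$ by a smooth timelike curve are exactly $q$ itself and the points of $\mathcal I^+$ that can be reached from $q$ by a past-directed null geodesic; equivalently, they are exactly the points of the segment with future endpoint $q$ (included) of the null generator of $\mathcal I^+$ through $q$, that is, $q$ and the points reached from $q$ by a past-directed null geodesic contained in $\mathcal I^+$. -/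

import Mathlib

noncomputable section

open Set Real
open scoped ContDiff

/-- Ambient space `ℝ × ℝ^{d+1}` of the Einstein cylinder `ℝ × S^d`. A point `x` has time coordinate
`T = x.1` and position `x.2`, which lies on the unit sphere `S^d` for points of the cylinder. -/
abbrev Ambient (d : ℕ) : Type := ℝ × EuclideanSpace ℝ (Fin (d + 1))

/-- The radial coordinate `χ ∈ [0, π]`: the angle between the position and the north pole
`(1, 0, …, 0)` of `S^d`. -/
def polarAngle {d : ℕ} (x : Ambient d) : ℝ := arccos (x.2 0)

/-- The quadratic form of `dT² - dω_d²`, where `dω_d² = dχ² + sin² χ dω_{d-1}²` is the round metric,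
i.e. the one that `S^d` inherits from `ℝ^{d+1}`; evaluated on a tangent vector of the cylinder. -/
def lineElement {d : ℕ} (v : Ambient d) : ℝ := v.1 ^ 2 - ‖v.2‖ ^ 2

/-- The conformal embedding of Minkowski space into the cylinder: with `r = ‖x‖`,
`t - r = tan P`, `t + r = tan Q`, `T = Q + P`, `χ = Q - P`, the event `(t, x)` goes to time `T` and
to the point `(cos χ, sin χ · x / r)` of `S^d` (the north pole if `x = 0`). -/
def minkowskiEmbedding (d : ℕ) (z : ℝ × EuclideanSpace ℝ (Fin d)) : Ambient d :=
  (arctan (z.1 + ‖z.2‖) + arctan (z.1 - ‖z.2‖),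
    WithLp.toLp 2 (Fin.cons (cos (arctan (z.1 + ‖z.2‖) - arctan (z.1 - ‖z.2‖)))
      (fun i => sin (arctan (z.1 + ‖z.2‖) - arctan (z.1 - ‖z.2‖)) * (z.2 i / ‖z.2‖))))

/-- The physical spacetime `M`: Minkowski space `𝕄^{(1,d)}` inside its compactification. -/
def physicalSpacetime (d : ℕ) : Set (Ambient d) := Set.range (minkowskiEmbedding d)

/-- The compactified spacetime `M̃ = {|T| ≤ π - χ}`. -/
def compactifiedMinkowski (d : ℕ) : Set (Ambient d) :=
  {x | ‖x.2‖ = 1 ∧ |x.1| ≤ π - polarAngle x}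

/-- Future null infinity `𝓘⁺`. -/
def scriPlus (d : ℕ) : Set (Ambient d) :=
  {x | ‖x.2‖ = 1 ∧ 0 < polarAngle x ∧ polarAngle x < π ∧ x.1 = π - polarAngle x}

/-- Past null infinity `𝓘⁻`. -/
def scriMinus (d : ℕ) : Set (Ambient d) :=
  {x | ‖x.2‖ = 1 ∧ 0 < polarAngle x ∧ polarAngle x < π ∧ x.1 = -(π - polarAngle x)}

/-- Spatial infinity `i⁰`: time `0` at the south pole (`χ = π`). -/
def spatialInfinity (d : ℕ) : Ambient d := (0, -EuclideanSpace.single 0 1)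

/-- Velocity of a curve with parameter interval `[0, 1]` (one-sided at the endpoints). -/
def velocity {d : ℕ} (γ : ℝ → Ambient d) (s : ℝ) : Ambient d := derivWithin γ (Icc 0 1) s

/-- Second derivative, in the ambient space, of a curve with parameter interval `[0, 1]`. -/
def acceleration {d : ℕ} (γ : ℝ → Ambient d) (s : ℝ) : Ambient d :=
  derivWithin (velocity γ) (Icc 0 1) s

/-- `γ` restricts to a smooth curve `[0, 1] → M̃` from `a` to `b`. -/
structure IsSmoothCurve {d : ℕ} (γ : ℝ → Ambient d) (a b : Ambient d) : Prop where
  smooth : ContDiffOn ℝ ∞ γ (Icc 0 1)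
  mem : ∀ s ∈ Icc (0 : ℝ) 1, γ s ∈ compactifiedMinkowski d
  source : γ 0 = a
  target : γ 1 = b

/-- The curve is timelike (of either time direction). -/
def IsTimelike {d : ℕ} (γ : ℝ → Ambient d) : Prop :=
  ∀ s ∈ Icc (0 : ℝ) 1, 0 < lineElement (velocity γ s)

/-- The curve is causal: its velocity is nonzero and timelike or null. -/
def IsCausal {d : ℕ} (γ : ℝ → Ambient d) : Prop :=
  ∀ s ∈ Icc (0 : ℝ) 1, velocity γ s ≠ 0 ∧ 0 ≤ lineElement (velocity γ s)

/-- The curve is null: its velocity is nonzero and null. -/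
def IsNull {d : ℕ} (γ : ℝ → Ambient d) : Prop :=
  ∀ s ∈ Icc (0 : ℝ) 1, velocity γ s ≠ 0 ∧ lineElement (velocity γ s) = 0

/-- The curve is future directed. -/
def IsFutureDirected {d : ℕ} (γ : ℝ → Ambient d) : Prop :=
  ∀ s ∈ Icc (0 : ℝ) 1, 0 < (velocity γ s).1

/-- Affinely parametrized geodesics of the product `ℝ × S^d`: `T'' = 0` and `ω'' = -‖ω'‖² ω`. -/
def IsGeodesic {d : ℕ} (γ : ℝ → Ambient d) : Prop :=
  ∀ s ∈ Icc (0 : ℝ) 1, acceleration γ s = (0, -(‖(velocity γ s).2‖ ^ 2) • (γ s).2)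

/-- `γ` is a future directed null geodesic in `M̃` from `a` to `b`. Run backwards, it is a past
directed null geodesic from `b` to `a`. -/
structure IsFutureNullGeodesic {d : ℕ} (γ : ℝ → Ambient d) (a b : Ambient d) : Prop
    extends IsSmoothCurve γ a b where
  geodesic : IsGeodesic γ
  null : IsNull γ
  future : IsFutureDirected γ

/-- The curve enters the physical spacetime `M`. -/
def EntersPhysical {d : ℕ} (γ : ℝ → Ambient d) : Prop :=
  ∃ s ∈ Icc (0 : ℝ) 1, γ s ∈ physicalSpacetime d

/-- `a` and `b` are connected by a smooth timelike curve in `M̃`. -/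
def TimelikeConnected {d : ℕ} (a b : Ambient d) : Prop :=
  ∃ γ : ℝ → Ambient d, IsSmoothCurve γ a b ∧ IsTimelike γ

/-- `I⁺(p) ⊆ M̃`. -/
def chronologicalFuture {d : ℕ} (p : Ambient d) : Set (Ambient d) :=
  {q | q ∈ compactifiedMinkowski d ∧
    ∃ γ : ℝ → Ambient d, IsSmoothCurve γ p q ∧ IsTimelike γ ∧ IsFutureDirected γ}

/-- `J⁺(p) ⊆ M̃`; as usual `p` itself (the trivial curve) is included. -/
def causalFuture {d : ℕ} (p : Ambient d) : Set (Ambient d) :=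
  {q | q ∈ compactifiedMinkowski d ∧ (q = p ∨
    ∃ γ : ℝ → Ambient d, IsSmoothCurve γ p q ∧ IsCausal γ ∧ IsFutureDirected γ)}

/-- `J⁻(p) ⊆ M̃`. -/
def causalPast {d : ℕ} (p : Ambient d) : Set (Ambient d) :=
  {q | q ∈ compactifiedMinkowski d ∧ p ∈ causalFuture q}

/-- The topological boundary of `A ⊆ M̃` in the space `M̃`. -/
def boundaryInCompactified {d : ℕ} (A : Set (Ambient d)) : Set (Ambient d) :=
  Subtype.val '' frontier (Subtype.val ⁻¹' A : Set (compactifiedMinkowski d))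

/-- The segment that ends at `q` of the null generator of `𝓘⁺` through `q`: the point `q` and the
points from which a future directed null geodesic that stays in `𝓘⁺` leads to `q`. -/
def pastGeneratorSegment {d : ℕ} (q : Ambient d) : Set (Ambient d) :=
  {r | r = q ∨ ∃ γ : ℝ → Ambient d, IsFutureNullGeodesic γ r q ∧
    ∀ s ∈ Icc (0 : ℝ) 1, γ s ∈ scriPlus d}

/-- In the coordinates of the cylinder, Minkowski space is `{|T| < π - χ}`. -/
theorem physicalSpacetime_eq (d : ℕ) :
    physicalSpacetime d = {x : Ambient d | ‖x.2‖ = 1 ∧ |x.1| < π - polarAngle x} := by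
  ext x
  constructor
  · rintro ⟨⟨t, y⟩, rfl⟩
    have hr : 0 ≤ ‖y‖ := norm_nonneg y
    have h1 : arctan (t - ‖y‖) ≤ arctan (t + ‖y‖) := arctan_mono (by linarith)
    have h2 := arctan_lt_pi_div_two (t + ‖y‖)
    have h3 := neg_pi_div_two_lt_arctan (t - ‖y‖)
    refine ⟨?_, ?_⟩
    · have : ‖(minkowskiEmbedding d (t, y)).2‖ ^ 2 = 1 := by
        simp only [minkowskiEmbedding, EuclideanSpace.norm_sq_eq, Fin.sum_univ_succ,
          Fin.cons_zero, Fin.cons_succ, Real.norm_eq_abs, sq_abs]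
        simp only [mul_pow, div_pow, ← Finset.mul_sum, ← Finset.sum_div]
        have hy : ∑ i, y i ^ 2 = ‖y‖ ^ 2 := by
          simp [EuclideanSpace.norm_sq_eq]
        rw [hy]
        rcases eq_or_ne y 0 with rfl | h
        · simp
        · rw [div_self (by simpa using h), mul_one, cos_sq_add_sin_sq]
      nlinarith [norm_nonneg (minkowskiEmbedding d (t, y)).2]
    · simp only [minkowskiEmbedding, polarAngle, Fin.cons_zero]
      rw [arccos_cos (by linarith) (by linarith), abs_lt]
      constructor <;> linarith
  · rintro ⟨hn, hT⟩
    obtain ⟨T, w⟩ := x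
    simp only [polarAngle] at hn hT
    have hsum : w 0 ^ 2 + ∑ i : Fin d, w i.succ ^ 2 = 1 := by
      have := EuclideanSpace.norm_sq_eq w
      rw [hn, Fin.sum_univ_succ] at this
      simpa using this.symm
    have hs0 : 0 ≤ ∑ i : Fin d, w i.succ ^ 2 := Finset.sum_nonneg fun i _ => sq_nonneg _
    have hw1 : w 0 ≤ 1 := by nlinarith
    have hw2 : -1 ≤ w 0 := by nlinarith
    set χ := arccos (w 0) with hχ
    have hcos : cos χ = w 0 := cos_arccos hw2 hw1
    have hχ0 : 0 ≤ χ := arccos_nonneg _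
    obtain ⟨hT1, hT2⟩ := abs_lt.1 hT
    have hχπ : χ < π := by linarith
    have hsinsq : ∑ i : Fin d, w i.succ ^ 2 = sin χ ^ 2 := by
      have := sin_sq_add_cos_sq χ
      rw [hcos] at this
      linarith
    have hP : arctan (tan ((T - χ) / 2)) = (T - χ) / 2 := arctan_tan (by linarith) (by linarith)
    have hQ : arctan (tan ((T + χ) / 2)) = (T + χ) / 2 := arctan_tan (by linarith) (by linarith)
    set u := tan ((T - χ) / 2) with hu
    set v := tan ((T + χ) / 2) with hv
    have huv : u ≤ v := by
      have : arctan u ≤ arctan v := by rw [hP, hQ]; linarith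
      exact arctan_strictMono.le_iff_le.1 this
    rcases hχ0.eq_or_lt with h0 | hpos
    · have hz : ∀ i : Fin d, w i.succ = 0 := by
        intro i
        have : ∑ i : Fin d, w i.succ ^ 2 = 0 := by rw [hsinsq, ← h0]; simp
        have := (Finset.sum_eq_zero_iff_of_nonneg (fun i _ => sq_nonneg _)).1 this i
          (Finset.mem_univ i)
        exact pow_eq_zero_iff (two_ne_zero) |>.1 this
      have huv' : u = v := by rw [hu, hv, ← h0]; simp
      refine ⟨(u, 0), ?_⟩
      simp only [minkowskiEmbedding, norm_zero, add_zero, sub_zero, sub_self]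
      refine Prod.ext ?_ ?_
      · simp only [hP]; linarith
      · ext i
        refine Fin.cases ?_ (fun j => ?_) i
        · simp [← hcos, ← h0]
        · simp [hz]
    · have hsin : 0 < sin χ := sin_pos_of_pos_of_lt_pi hpos hχπ
      have huv' : u < v := by
        have : arctan u < arctan v := by rw [hP, hQ]; linarith
        exact arctan_strictMono.lt_iff_lt.1 this
      set r := (v - u) / 2 with hr
      have hrpos : 0 < r := by rw [hr]; linarith
      set y : EuclideanSpace ℝ (Fin d) := WithLp.toLp 2 (fun i => r / sin χ * w i.succ) with hy
      have hyn : ‖y‖ = r := by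
        have : ‖y‖ ^ 2 = r ^ 2 := by
          simp only [hy, EuclideanSpace.norm_sq_eq, Real.norm_eq_abs, sq_abs, mul_pow,
            ← Finset.mul_sum, hsinsq]
          field_simp
        exact (pow_left_inj₀ (norm_nonneg _) hrpos.le two_ne_zero).1 this
      refine ⟨((u + v) / 2, y), ?_⟩
      have e1 : (u + v) / 2 + r = v := by rw [hr]; ring
      have e2 : (u + v) / 2 - r = u := by rw [hr]; ring
      simp only [minkowskiEmbedding, hyn, e1, e2, hP, hQ]
      have e3 : (T + χ) / 2 - (T - χ) / 2 = χ := by ring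
      rw [e3]
      refine Prod.ext ?_ ?_
      · simp only; ring
      · ext i
        refine Fin.cases ?_ (fun j => ?_) i
        · simp [hcos]
        · simp only [Fin.cons_succ, hy]
          field_simp

end

open Set Real
open scoped ContDiff
open InnerProductGeometry Filter Topology

/-! ### Spherical geometry: angles, lengths of curves, great circles -/

section Sphere

variable {E : Type*} [NormedAddCommGroup E] [InnerProductSpace ℝ E]

/-! Causality on the cylinder is a comparison of angle with elapsed time: a causal curve sweeps an
angle at most the elapsed time, a timelike one strictly less (`angle_lt_of_timelikeConnected`).
Conversely, if the angle is less than the elapsed time, a uniformly traversed great circle arc is a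
timelike curve, and it stays in `M̃` (`mem_chronologicalFuture_of_angle_lt`). The reason is that `π
- χ` is the angle to the south pole, so that `M̃` consists of the points not timelike related to
`i⁰`, and the triangle inequality applies.

Null geodesics are great circles run at the speed of light. Along one that starts at `p`, the
function `ω₀ + cos T`, which vanishes on `𝓘⁺`, `𝓘⁻` and at `i⁰` and is positive on `M`, equals a
constant times the sine of the elapsed time (`coord_add_cos_greatCircleCurve`). A ray that enters
`M` therefore meets `𝓘⁺` only after time `π`, at the position antipodal to `p`; this is `q =
refocusPoint p`.

Replacing `p` by its antipode turns angle and time into their complements to `π`, so "`r` is not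
timelike later than `p`" becomes "the angle from `r` to `q` is at most the time from `r` to `q`".
For `r` on `𝓘⁺` this leaves only the null generator through `q`
(`mem_pastGeneratorSegment_of_le_angle`). -/

lemma angle_eq_arccos_inner {u v : E} (hu : ‖u‖ = 1) (hv : ‖v‖ = 1) :
    angle u v = arccos (inner ℝ u v) := by
  simp [angle, hu, hv]

lemma cos_angle_of_unit {u v : E} (hu : ‖u‖ = 1) (hv : ‖v‖ = 1) :
    cos (angle u v) = inner ℝ u v := by
  simp [cos_angle, hu, hv]

lemma inner_self_of_unit {u : E} (hu : ‖u‖ = 1) : inner ℝ u u = (1 : ℝ) := by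
  rw [real_inner_self_eq_norm_sq, hu, one_pow]

lemma norm_eq_one_of_inner_self {u : E} (hu : inner ℝ u u = (1 : ℝ)) : ‖u‖ = 1 := by
  rw [real_inner_self_eq_norm_sq] at hu
  nlinarith [norm_nonneg u]

/-- The angle between two unit vectors in terms of the chord. -/
lemma angle_eq_two_mul_arcsin {u v : E} (hu : ‖u‖ = 1) (hv : ‖v‖ = 1) :
    angle u v = 2 * arcsin (‖v - u‖ / 2) := by
  have h0 := angle_nonneg u v
  have h1 := angle_le_pi u v
  have hs : 0 ≤ sin (angle u v / 2) := sin_nonneg_of_nonneg_of_le_pi (by linarith) (by linarith)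
  have h2 : ‖v - u‖ ^ 2 = (2 * sin (angle u v / 2)) ^ 2 := by
    have hc : cos (angle u v) = 1 - 2 * sin (angle u v / 2) ^ 2 := by
      have := cos_two_mul (angle u v / 2)
      rw [show 2 * (angle u v / 2) = angle u v by ring] at this
      nlinarith [sin_sq_add_cos_sq (angle u v / 2)]
    rw [cos_angle_of_unit hu hv] at hc
    rw [norm_sub_sq_real, hu, hv, real_inner_comm]
    nlinarith
  have h3 : ‖v - u‖ = 2 * sin (angle u v / 2) :=
    (pow_left_inj₀ (norm_nonneg _) (by positivity) two_ne_zero).1 h2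
  rw [h3, mul_div_cancel_left₀ _ two_ne_zero, arcsin_sin (by linarith) (by linarith)]
  ring

/-- The norm is not differentiable at `0`, but to the right of `x` the slope of the chord length is
the norm of the slope of `f`. -/
lemma hasDerivWithinAt_norm_sub {f : ℝ → E} {f' : E} {x : ℝ}
    (h : HasDerivWithinAt f f' (Ici x) x) :
    HasDerivWithinAt (fun z => ‖f z - f x‖) ‖f'‖ (Ici x) x := by
  rw [← hasDerivWithinAt_Ioi_iff_Ici] at h ⊢
  rw [hasDerivWithinAt_iff_tendsto_slope' self_notMem_Ioi] at h ⊢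
  refine h.norm.congr' ?_
  filter_upwards [self_mem_nhdsWithin] with z hz
  have : 0 < z - x := sub_pos.2 hz
  simp [slope, norm_smul, abs_of_pos this]

/-- The angle between the ends of a curve on the unit sphere is at most its length. -/
lemma angle_le_of_norm_deriv_le {f f' : ℝ → E} {B B' : ℝ → ℝ}
    (hf : ∀ s ∈ Icc (0 : ℝ) 1, HasDerivWithinAt f (f' s) (Icc 0 1) s)
    (hB : ∀ s ∈ Icc (0 : ℝ) 1, HasDerivWithinAt B (B' s) (Icc 0 1) s)
    (hn : ∀ s ∈ Icc (0 : ℝ) 1, ‖f s‖ = 1)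
    (h : ∀ s ∈ Icc (0 : ℝ) 1, ‖f' s‖ ≤ B' s) :
    angle (f 0) (f 1) ≤ B 1 - B 0 := by
  have h01 : (0 : ℝ) ∈ Icc (0 : ℝ) 1 := by simp
  have hfc : ContinuousOn f (Icc 0 1) := fun s hs => (hf s hs).continuousWithinAt
  have hBc : ContinuousOn B (Icc 0 1) := fun s hs => (hB s hs).continuousWithinAt
  have key : ∀ ⦃x⦄, x ∈ Icc (0 : ℝ) 1 → angle (f 0) (f x) ≤ B x - B 0 := by
    -- The angle to `f 0` need not be differentiable, so only its right difference quotients are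
    -- bounded: by the triangle inequality they are at most those of the angle to `f x`.
    refine image_le_of_liminf_slope_right_le_deriv_boundary (B' := B') ?_ ?_
      (hBc.sub continuousOn_const) ?_ ?_
    · have : ContinuousOn (fun s => arccos (inner ℝ (f 0) (f s))) (Icc 0 1) :=
        continuous_arccos.comp_continuousOn (continuousOn_const.inner hfc)
      exact this.congr fun s hs => angle_eq_arccos_inner (hn 0 h01) (hn s hs)
    · rw [angle_self (by intro h0; simpa [h0] using hn 0 h01)]; simp
    · intro x hx
      have := (hB x ⟨hx.1, hx.2.le⟩).sub_const (B 0)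
      exact this.mono_of_mem_nhdsWithin (mem_of_superset (Icc_mem_nhdsGE hx.2)
        (Icc_subset_Icc_left hx.1))
    · intro x hx r hr
      have hxI : x ∈ Icc (0 : ℝ) 1 := ⟨hx.1, hx.2.le⟩
      have hd : HasDerivWithinAt f (f' x) (Ici x) x :=
        (hf x hxI).mono_of_mem_nhdsWithin (mem_of_superset (Icc_mem_nhdsGE hx.2)
          (Icc_subset_Icc_left hx.1))
      -- The chord formula is differentiable at coinciding points, where `arccos` of the inner
      -- product is singular.
      have ha : HasDerivAt (fun y : ℝ => 2 * arcsin (y / 2)) 1 (‖f x - f x‖) := by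
        have h1 : HasDerivAt arcsin 1 ((‖f x - f x‖) / 2) := by
          have := hasDerivAt_arcsin (x := 0) (by norm_num) (by norm_num)
          simpa using this
        have h2 : HasDerivAt (fun y : ℝ => y / 2) (1 / 2) (‖f x - f x‖) :=
          (hasDerivAt_id _).div_const 2
        have := (HasDerivAt.comp (‖f x - f x‖) h1 h2).const_mul 2
        simpa [Function.comp_def] using this
      have hc := ha.comp_hasDerivWithinAt x (hasDerivWithinAt_norm_sub hd)
      rw [← hasDerivWithinAt_Ioi_iff_Ici,
        hasDerivWithinAt_iff_tendsto_slope' self_notMem_Ioi, one_mul] at hc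
      have hlt := hc.eventually_lt_const ((h x hxI).trans_lt hr)
      refine Eventually.frequently ?_
      filter_upwards [hlt, Icc_mem_nhdsGT hx.2, self_mem_nhdsWithin] with z hz hz1 hz2
      refine lt_of_le_of_lt ?_ hz
      have hzI : z ∈ Icc (0 : ℝ) 1 := ⟨hx.1.trans hz1.1, hz1.2⟩
      have hpos : 0 < z - x := sub_pos.2 hz2
      have htri := angle_le_angle_add_angle (f 0) (f x) (f z)
      rw [angle_eq_two_mul_arcsin (hn x hxI) (hn z hzI)] at htri
      simp only [slope_def_field, Function.comp_def, sub_self, norm_zero, zero_div, arcsin_zero,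
        mul_zero, sub_zero]
      gcongr
      linarith
  exact key (by simp)

/-- Two unit vectors lie on a common great circle. -/
lemma exists_greatCircle {a b n : E} (ha : ‖a‖ = 1) (hb : ‖b‖ = 1) (hn : ‖n‖ = 1)
    (han : inner ℝ a n = (0 : ℝ)) :
    ∃ u : E, ‖u‖ = 1 ∧ inner ℝ a u = (0 : ℝ) ∧
      b = cos (angle a b) • a + sin (angle a b) • u := by
  have hc := cos_angle_of_unit ha hb
  by_cases hs : sin (angle a b) = 0
  -- Here `b = ± a`, so every unit tangent vector serves; `n` is needed only for this case.
  · refine ⟨n, hn, han, ?_⟩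
    rw [hs, zero_smul, add_zero, ← sub_eq_zero, ← inner_self_eq_zero (𝕜 := ℝ)]
    have := sin_sq_add_cos_sq (angle a b)
    rw [hs] at this
    simp only [inner_sub_left, inner_sub_right, inner_smul_left, inner_smul_right,
      inner_self_of_unit ha, inner_self_of_unit hb, real_inner_comm a b, ← hc, conj_trivial]
    linarith
  · refine ⟨(sin (angle a b))⁻¹ • (b - cos (angle a b) • a), ?_, ?_, ?_⟩
    · apply norm_eq_one_of_inner_self
      simp only [inner_sub_left, inner_sub_right, inner_smul_left, inner_smul_right,
        inner_self_of_unit ha, inner_self_of_unit hb, real_inner_comm a b, ← hc, conj_trivial]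
      field_simp
      linarith [sin_sq_add_cos_sq (angle a b)]
    · simp only [inner_sub_right, inner_smul_right, inner_self_of_unit ha, ← hc]
      ring
    · rw [smul_smul, mul_inv_cancel₀ hs, one_smul]; abel

/-- Solutions of `f'' = -k² f` on the unit interval. -/
lemma harmonic_eq {f g : ℝ → E} {k : ℝ} (hk : k ≠ 0)
    (hf : ∀ s ∈ Icc (0 : ℝ) 1, HasDerivWithinAt f (g s) (Icc 0 1) s)
    (hg : ∀ s ∈ Icc (0 : ℝ) 1, HasDerivWithinAt g (-(k ^ 2) • f s) (Icc 0 1) s) :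
    ∀ s ∈ Icc (0 : ℝ) 1, f s = cos (k * s) • f 0 + sin (k * s) • (k⁻¹ • g 0) := by
  have hks : ∀ s : ℝ, HasDerivAt (fun s => k * s) k s := fun s => by
    simpa using (hasDerivAt_id s).const_mul k
  have hcos : ∀ s, HasDerivWithinAt (fun s => cos (k * s)) (-sin (k * s) * k) (Icc 0 1) s :=
    fun s => (hks s).cos.hasDerivWithinAt
  have hsin : ∀ s, HasDerivWithinAt (fun s => sin (k * s)) (cos (k * s) * k) (Icc 0 1) s :=
    fun s => (hks s).sin.hasDerivWithinAt
  -- Rotating the pair `(f, k⁻¹ g)` back by the angle `k s` gives two constants of motion; undoing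
  -- the rotation yields the formula.
  have h1 : ∀ s ∈ Icc (0 : ℝ) 1, HasDerivWithinAt
      (fun s => cos (k * s) • f s - sin (k * s) • (k⁻¹ • g s)) 0 (Icc 0 1) s := by
    intro s hs
    refine HasDerivWithinAt.congr_deriv (((hcos s).smul (hf s hs)).sub
      ((hsin s).smul ((hg s hs).const_smul k⁻¹))) ?_
    match_scalars <;> field_simp <;> ring
  have h2 : ∀ s ∈ Icc (0 : ℝ) 1, HasDerivWithinAt
      (fun s => sin (k * s) • f s + cos (k * s) • (k⁻¹ • g s)) 0 (Icc 0 1) s := by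
    intro s hs
    refine HasDerivWithinAt.congr_deriv (((hsin s).smul (hf s hs)).add
      ((hcos s).smul ((hg s hs).const_smul k⁻¹))) ?_
    match_scalars <;> field_simp <;> ring
  have hconst : ∀ F : ℝ → E, (∀ s ∈ Icc (0 : ℝ) 1, HasDerivWithinAt F 0 (Icc 0 1) s) →
      ∀ s ∈ Icc (0 : ℝ) 1, F s = F 0 := fun F hF =>
    constant_of_derivWithin_zero (fun s hs => (hF s hs).differentiableWithinAt) fun s hs =>
      (hF s ⟨hs.1, hs.2.le⟩).derivWithin (uniqueDiffOn_Icc one_pos s ⟨hs.1, hs.2.le⟩)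
  intro s hs
  have e1 := hconst _ h1 s hs
  have e2 := hconst _ h2 s hs
  simp only [mul_zero, cos_zero, sin_zero, one_smul, zero_smul, sub_zero, zero_add] at e1 e2
  rw [← e1, ← e2]
  match_scalars
  · linarith [sin_sq_add_cos_sq (k * s)]
  · ring

end Sphere

/-! ### The regions of the cylinder in terms of `ω₀ + cos T` -/

lemma inner_southPole {d : ℕ} (w : EuclideanSpace ℝ (Fin (d + 1))) :
    inner ℝ w (spatialInfinity d).2 = -w 0 := by
  simp [spatialInfinity, inner_neg_right, EuclideanSpace.inner_single_right]

lemma norm_southPole (d : ℕ) : ‖(spatialInfinity d).2‖ = 1 := by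
  simp [spatialInfinity]

lemma abs_coord_zero_le {d : ℕ} {w : EuclideanSpace ℝ (Fin (d + 1))} (hw : ‖w‖ = 1) :
    |w 0| ≤ 1 := by
  have := abs_real_inner_le_norm w (spatialInfinity d).2
  rwa [inner_southPole, norm_southPole, hw, abs_neg, one_mul] at this

lemma eq_southPole {d : ℕ} {w : EuclideanSpace ℝ (Fin (d + 1))} (hw : ‖w‖ = 1)
    (h0 : w 0 = -1) : w = (spatialInfinity d).2 := by
  refine (inner_eq_one_iff_of_norm_eq_one (𝕜 := ℝ) hw (norm_southPole d)).1 ?_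
  rw [inner_southPole, h0, neg_neg]

lemma angle_southPole {d : ℕ} {x : Ambient d} (hx : ‖x.2‖ = 1) :
    angle x.2 (spatialInfinity d).2 = π - polarAngle x := by
  rw [angle_eq_arccos_inner hx (norm_southPole d), inner_southPole, arccos_neg, polarAngle]

lemma cos_polarAngle {d : ℕ} {x : Ambient d} (hx : ‖x.2‖ = 1) : cos (polarAngle x) = x.2 0 := by
  have := abs_le.1 (abs_coord_zero_le hx)
  exact cos_arccos this.1 this.2

lemma polarAngle_mem {d : ℕ} (x : Ambient d) : polarAngle x ∈ Icc 0 π :=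
  ⟨arccos_nonneg _, arccos_le_pi _⟩

/-- Cosine is strictly decreasing on `[0, π]`, which trades `arccos` for the sign of `ω₀ + cos T`;
the bound on `|T|` has to be kept for the way back. -/
lemma mem_compactified_iff {d : ℕ} {x : Ambient d} :
    x ∈ compactifiedMinkowski d ↔ ‖x.2‖ = 1 ∧ |x.1| ≤ π ∧ -cos x.1 ≤ x.2 0 := by
  refine and_congr_right fun hx => ?_
  have hm := polarAngle_mem x
  have hc : cos (π - polarAngle x) = -x.2 0 := by rw [cos_pi_sub, cos_polarAngle hx]
  have key (h : |x.1| ≤ π) : |x.1| ≤ π - polarAngle x ↔ -cos x.1 ≤ x.2 0 := by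
    rw [← strictAntiOn_cos.le_iff_ge ⟨sub_nonneg.2 hm.2, by linarith [hm.1]⟩ ⟨abs_nonneg _, h⟩,
      hc, cos_abs, neg_le]
  constructor
  · intro h
    have h' : |x.1| ≤ π := by linarith [hm.1]
    exact ⟨h', (key h').1 h⟩
  · exact fun h => (key h.1).2 h.2

lemma mem_physical_iff {d : ℕ} {x : Ambient d} :
    x ∈ physicalSpacetime d ↔ ‖x.2‖ = 1 ∧ |x.1| ≤ π ∧ -cos x.1 < x.2 0 := by
  rw [physicalSpacetime_eq]
  refine and_congr_right fun hx => ?_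
  have hm := polarAngle_mem x
  have hc : cos (π - polarAngle x) = -x.2 0 := by rw [cos_pi_sub, cos_polarAngle hx]
  have key (h : |x.1| ≤ π) : |x.1| < π - polarAngle x ↔ -cos x.1 < x.2 0 := by
    rw [← strictAntiOn_cos.lt_iff_gt ⟨sub_nonneg.2 hm.2, by linarith [hm.1]⟩ ⟨abs_nonneg _, h⟩,
      hc, cos_abs, neg_lt]
  constructor
  · intro h
    have h' : |x.1| ≤ π := by linarith [hm.1]
    exact ⟨h', (key h').1 h⟩
  · exact fun h => (key h.1).2 h.2

lemma mem_scriPlus_iff {d : ℕ} {x : Ambient d} :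
    x ∈ scriPlus d ↔ ‖x.2‖ = 1 ∧ 0 < x.1 ∧ x.1 < π ∧ x.2 0 = -cos x.1 := by
  refine and_congr_right fun hx => ?_
  constructor
  · rintro ⟨h1, h2, h3⟩
    refine ⟨by linarith, by linarith, ?_⟩
    rw [h3, cos_pi_sub, cos_polarAngle hx, neg_neg]
  · rintro ⟨h1, h2, h3⟩
    have : polarAngle x = π - x.1 := by
      rw [polarAngle, h3, arccos_neg, arccos_cos h1.le h2.le]
    exact ⟨by linarith, by linarith, by linarith⟩

lemma mem_scriMinus_iff {d : ℕ} {x : Ambient d} :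
    x ∈ scriMinus d ↔ ‖x.2‖ = 1 ∧ -π < x.1 ∧ x.1 < 0 ∧ x.2 0 = -cos x.1 := by
  refine and_congr_right fun hx => ?_
  constructor
  · rintro ⟨h1, h2, h3⟩
    refine ⟨by linarith, by linarith, ?_⟩
    rw [h3, cos_neg, cos_pi_sub, cos_polarAngle hx, neg_neg]
  · rintro ⟨h1, h2, h3⟩
    have : polarAngle x = π + x.1 := by
      rw [polarAngle, h3, arccos_neg, ← cos_neg, arccos_cos (by linarith) (by linarith)]
      ring
    exact ⟨by linarith, by linarith, by linarith⟩

lemma scriPlus_subset (d : ℕ) : scriPlus d ⊆ compactifiedMinkowski d := by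
  intro x hx
  obtain ⟨h1, h2, h3, h4⟩ := mem_scriPlus_iff.1 hx
  exact mem_compactified_iff.2 ⟨h1, abs_le.2 ⟨by linarith, h3.le⟩, h4.ge⟩

lemma scriMinus_subset (d : ℕ) : scriMinus d ⊆ compactifiedMinkowski d := by
  intro x hx
  obtain ⟨h1, h2, h3, h4⟩ := mem_scriMinus_iff.1 hx
  exact mem_compactified_iff.2 ⟨h1, abs_le.2 ⟨h2.le, by linarith⟩, h4.ge⟩

/-- The unit tangent vector of the sphere that points north. -/
lemma exists_northward {d : ℕ} {w : EuclideanSpace ℝ (Fin (d + 1))} {τ : ℝ} (hw : ‖w‖ = 1)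
    (h0 : w 0 = -cos τ) (hτ : 0 < sin τ) :
    ∃ u : EuclideanSpace ℝ (Fin (d + 1)), ‖u‖ = 1 ∧ inner ℝ w u = (0 : ℝ) ∧ u 0 = sin τ ∧
      ∀ v, inner ℝ v u = (sin τ)⁻¹ * (v 0 + cos τ * inner ℝ v w) := by
  -- The witness is the component of the north pole `-S` orthogonal to `w`, divided by its length
  -- `sin τ`.
  set S := (spatialInfinity d).2 with hS
  have hin : ∀ v, inner ℝ v ((sin τ)⁻¹ • (cos τ • w - S)) =
      (sin τ)⁻¹ * (v 0 + cos τ * inner ℝ v w) := by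
    intro v
    simp only [inner_smul_right, inner_sub_right, inner_southPole, hS]
    ring
  have hsc := sin_sq_add_cos_sq τ
  have hu0 : ((sin τ)⁻¹ • (cos τ • w - S)) 0 = sin τ := by
    have : S 0 = -1 := by simp [hS, spatialInfinity]
    simp only [PiLp.smul_apply, PiLp.sub_apply, h0, this, smul_eq_mul]
    field_simp
    linarith
  have hwu : inner ℝ w ((sin τ)⁻¹ • (cos τ • w - S)) = (0 : ℝ) := by
    rw [hin, inner_self_of_unit hw, h0]; ring
  refine ⟨_, norm_eq_one_of_inner_self ?_, hwu, hu0, hin⟩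
  rw [hin, hu0, real_inner_comm, hwu]
  field_simp
  ring

/-! ### Curves over great circles -/

/-- The curve that starts at `a`, runs along the great circle with initial direction `u` at angular
speed `δ`, and for which time passes at the rate `k`. -/
noncomputable def greatCircleCurve {d : ℕ} (a : Ambient d) (u : EuclideanSpace ℝ (Fin (d + 1)))
    (k δ : ℝ) (s : ℝ) : Ambient d :=
  (a.1 + k * s, cos (δ * s) • a.2 + sin (δ * s) • u)

section GreatCircle

variable {d : ℕ} {a : Ambient d} {u : EuclideanSpace ℝ (Fin (d + 1))} {k δ : ℝ}

lemma inner_greatCircle (ha : ‖a.2‖ = 1) (hu : ‖u‖ = 1) (hau : inner ℝ a.2 u = (0 : ℝ))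
    (α β : ℝ) :
    inner ℝ (cos α • a.2 + sin α • u) (cos β • a.2 + sin β • u) = cos (β - α) := by
  simp only [inner_add_left, inner_add_right, inner_smul_left, inner_smul_right,
    inner_self_of_unit ha, inner_self_of_unit hu, hau, real_inner_comm a.2 u, conj_trivial, cos_sub]
  ring

lemma norm_greatCircle (ha : ‖a.2‖ = 1) (hu : ‖u‖ = 1) (hau : inner ℝ a.2 u = (0 : ℝ)) (α : ℝ) :
    ‖cos α • a.2 + sin α • u‖ = 1 :=
  norm_eq_one_of_inner_self (by rw [inner_greatCircle ha hu hau, sub_self, cos_zero])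

lemma hasDerivAt_greatCircleCurve (s : ℝ) :
    HasDerivAt (greatCircleCurve a u k δ)
      (k, δ • (-sin (δ * s) • a.2 + cos (δ * s) • u)) s := by
  have hδ : HasDerivAt (fun s => δ * s) δ s := by simpa using (hasDerivAt_id s).const_mul δ
  have hk : HasDerivAt (fun s => a.1 + k * s) k s := by
    simpa using ((hasDerivAt_id s).const_mul k).const_add a.1
  refine hk.prodMk ?_
  refine HasDerivAt.congr_deriv ((hδ.cos.smul_const a.2).add (hδ.sin.smul_const u)) ?_
  match_scalars <;> ring

lemma velocity_greatCircleCurve {s : ℝ} (hs : s ∈ Icc (0 : ℝ) 1) :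
    velocity (greatCircleCurve a u k δ) s =
      (k, δ • (-sin (δ * s) • a.2 + cos (δ * s) • u)) :=
  (hasDerivAt_greatCircleCurve s).hasDerivWithinAt.derivWithin (uniqueDiffOn_Icc one_pos s hs)

lemma norm_velocity_greatCircleCurve (ha : ‖a.2‖ = 1) (hu : ‖u‖ = 1)
    (hau : inner ℝ a.2 u = (0 : ℝ)) {s : ℝ} (hs : s ∈ Icc (0 : ℝ) 1) :
    ‖(velocity (greatCircleCurve a u k δ) s).2‖ ^ 2 = δ ^ 2 := by
  -- The direction of motion is the point of the circle a quarter turn ahead.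
  have := norm_greatCircle ha hu hau (δ * s + π / 2)
  rw [cos_add_pi_div_two, sin_add_pi_div_two] at this
  rw [velocity_greatCircleCurve hs, norm_smul, this, mul_one, norm_eq_abs, sq_abs]

lemma acceleration_greatCircleCurve {s : ℝ} (hs : s ∈ Icc (0 : ℝ) 1) :
    acceleration (greatCircleCurve a u k δ) s =
      (0, -(δ ^ 2) • (greatCircleCurve a u k δ s).2) := by
  have hδ : HasDerivAt (fun s => δ * s) δ s := by simpa using (hasDerivAt_id s).const_mul δ
  have h : HasDerivAt (fun s => ((k, δ • (-sin (δ * s) • a.2 + cos (δ * s) • u)) : Ambient d))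
      (0, -(δ ^ 2) • (greatCircleCurve a u k δ s).2) s := by
    refine (hasDerivAt_const s k).prodMk ?_
    refine HasDerivAt.congr_deriv
      (((hδ.sin.neg.smul_const a.2).add (hδ.cos.smul_const u)).const_smul δ) ?_
    simp only [greatCircleCurve]
    match_scalars <;> ring
  have h' := h.hasDerivWithinAt.congr_of_mem (s := Icc 0 1)
    (fun s hs => velocity_greatCircleCurve hs) hs
  exact h'.derivWithin (uniqueDiffOn_Icc one_pos s hs)

lemma lineElement_greatCircleCurve (ha : ‖a.2‖ = 1) (hu : ‖u‖ = 1)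
    (hau : inner ℝ a.2 u = (0 : ℝ)) {s : ℝ} (hs : s ∈ Icc (0 : ℝ) 1) :
    lineElement (velocity (greatCircleCurve a u k δ) s) = k ^ 2 - δ ^ 2 := by
  rw [lineElement, norm_velocity_greatCircleCurve ha hu hau hs, velocity_greatCircleCurve hs]

lemma greatCircleCurve_isFutureDirected (hk : 0 < k) :
    IsFutureDirected (greatCircleCurve a u k δ) := fun s hs => by
  rwa [velocity_greatCircleCurve hs]

lemma greatCircleCurve_isSmoothCurve
    (hmem : ∀ s ∈ Icc (0 : ℝ) 1, greatCircleCurve a u k δ s ∈ compactifiedMinkowski d) :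
    IsSmoothCurve (greatCircleCurve a u k δ) a (greatCircleCurve a u k δ 1) where
  smooth := by
    refine ContDiff.contDiffOn ?_
    unfold greatCircleCurve
    fun_prop
  mem := hmem
  source := by simp [greatCircleCurve]
  target := rfl

lemma greatCircleCurve_isFutureNullGeodesic (ha : ‖a.2‖ = 1) (hu : ‖u‖ = 1)
    (hau : inner ℝ a.2 u = (0 : ℝ)) (hk : 0 < k)
    (hmem : ∀ s ∈ Icc (0 : ℝ) 1, greatCircleCurve a u k k s ∈ compactifiedMinkowski d) :
    IsFutureNullGeodesic (greatCircleCurve a u k k) a (greatCircleCurve a u k k 1) where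
  toIsSmoothCurve := greatCircleCurve_isSmoothCurve hmem
  geodesic s hs := by
    rw [acceleration_greatCircleCurve hs, norm_velocity_greatCircleCurve ha hu hau hs]
  null s hs := by
    refine ⟨fun h => ?_, by rw [lineElement_greatCircleCurve ha hu hau hs, sub_self]⟩
    have := greatCircleCurve_isFutureDirected (a := a) (u := u) (δ := k) hk s hs
    simp [h] at this
  future := greatCircleCurve_isFutureDirected hk

end GreatCircle

/-! ### Causal, timelike and null curves compared with angles -/

section Curves

variable {d : ℕ} {γ : ℝ → Ambient d} {a b : Ambient d}

lemma IsSmoothCurve.hasDerivWithinAt (h : IsSmoothCurve γ a b) {s : ℝ} (hs : s ∈ Icc (0 : ℝ) 1) :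
    HasDerivWithinAt γ (velocity γ s) (Icc 0 1) s :=
  ((h.smooth.differentiableOn (by simp)) s hs).hasDerivWithinAt

lemma IsSmoothCurve.contDiffOn_velocity (h : IsSmoothCurve γ a b) :
    ContDiffOn ℝ ∞ (velocity γ) (Icc 0 1) :=
  h.smooth.derivWithin (uniqueDiffOn_Icc one_pos) (by simp)

lemma IsSmoothCurve.hasDerivWithinAt_velocity (h : IsSmoothCurve γ a b) {s : ℝ}
    (hs : s ∈ Icc (0 : ℝ) 1) :
    HasDerivWithinAt (velocity γ) (acceleration γ s) (Icc 0 1) s :=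
  ((h.contDiffOn_velocity.differentiableOn (by simp)) s hs).hasDerivWithinAt

lemma IsSmoothCurve.norm_eq_one (h : IsSmoothCurve γ a b) {s : ℝ} (hs : s ∈ Icc (0 : ℝ) 1) :
    ‖(γ s).2‖ = 1 := (h.mem s hs).1

lemma HasDerivWithinAt.ambient_fst {v : Ambient d} {t : Set ℝ} {s : ℝ}
    (h : HasDerivWithinAt γ v t s) : HasDerivWithinAt (fun s => (γ s).1) v.1 t s :=
  (ContinuousLinearMap.fst ℝ ℝ (EuclideanSpace ℝ (Fin (d + 1)))).hasFDerivAt.comp_hasDerivWithinAt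
    s h

lemma HasDerivWithinAt.ambient_snd {v : Ambient d} {t : Set ℝ} {s : ℝ}
    (h : HasDerivWithinAt γ v t s) : HasDerivWithinAt (fun s => (γ s).2) v.2 t s :=
  (ContinuousLinearMap.snd ℝ ℝ (EuclideanSpace ℝ (Fin (d + 1)))).hasFDerivAt.comp_hasDerivWithinAt
    s h

/-- A curve that is slower than light by at least `ε` covers an angle of at most the elapsed time
minus `ε`. -/
lemma IsSmoothCurve.angle_le (h : IsSmoothCurve γ a b) {ε : ℝ}
    (hv : ∀ s ∈ Icc (0 : ℝ) 1, ‖(velocity γ s).2‖ ≤ (velocity γ s).1 - ε) :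
    angle a.2 b.2 ≤ b.1 - a.1 - ε := by
  have := angle_le_of_norm_deriv_le (f := fun s => (γ s).2) (B := fun s => (γ s).1 - ε * s)
    (B' := fun s => (velocity γ s).1 - ε) (fun s hs => (h.hasDerivWithinAt hs).ambient_snd)
    (fun s hs => ((h.hasDerivWithinAt hs).ambient_fst.sub
      ((hasDerivWithinAt_id s (Icc 0 1)).const_mul ε)).congr_deriv (by rw [mul_one]))
    (fun s hs => h.norm_eq_one hs) hv
  simp only [h.source, h.target] at this
  linarith

lemma angle_le_of_mem_causalFuture (ha : ‖a.2‖ = 1) (h : b ∈ causalFuture a) :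
    angle a.2 b.2 ≤ b.1 - a.1 := by
  obtain ⟨-, rfl | ⟨γ, hγ, hc, hf⟩⟩ := h
  · rw [angle_self (by intro h0; simp [h0] at ha), sub_self]
  · have := hγ.angle_le (ε := 0) fun s hs => by
      rw [sub_zero]
      have := (hc s hs).2
      rw [lineElement, sub_nonneg] at this
      exact (pow_le_pow_iff_left₀ (norm_nonneg _) (hf s hs).le two_ne_zero).1 this
    rwa [sub_zero] at this

/-- A timelike curve, in whichever time direction it is traversed, covers an angle less than the
elapsed time. -/
lemma angle_lt_of_timelikeConnected (hab : a.1 < b.1) (h : TimelikeConnected a b) :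
    angle a.2 b.2 < b.1 - a.1 := by
  obtain ⟨γ, hγ, ht⟩ := h
  have hcont : ContinuousOn (velocity γ) (Icc 0 1) := hγ.contDiffOn_velocity.continuousOn
  have hc1 : ContinuousOn (fun s => (velocity γ s).1) (Icc 0 1) :=
    continuous_fst.comp_continuousOn hcont
  have hc2 : ContinuousOn (fun s => ‖(velocity γ s).2‖) (Icc 0 1) :=
    (continuous_snd.comp_continuousOn hcont).norm
  have hlt : ∀ s ∈ Icc (0 : ℝ) 1, ‖(velocity γ s).2‖ < |(velocity γ s).1| := fun s hs => by
    have := ht s hs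
    rw [lineElement, sub_pos, ← sq_abs (velocity γ s).1] at this
    exact (pow_lt_pow_iff_left₀ (norm_nonneg _) (abs_nonneg _) two_ne_zero).1 this
  -- The time component never vanishes, and it is positive somewhere by the mean value theorem,
  -- hence everywhere.
  have hne : ∀ s ∈ Icc (0 : ℝ) 1, (velocity γ s).1 ≠ 0 := fun s hs h0 => by
    have := hlt s hs
    rw [h0, abs_zero] at this
    exact (norm_nonneg _).not_gt this
  have h01 : (0 : ℝ) ∈ Icc (0 : ℝ) 1 := by simp
  have hγc : ContinuousOn (fun s => (γ s).1) (Icc 0 1) :=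
    continuous_fst.comp_continuousOn hγ.smooth.continuousOn
  obtain ⟨c, hc, hcd⟩ := exists_hasDerivAt_eq_slope (fun s => (γ s).1)
    (fun s => (velocity γ s).1) one_pos hγc fun s hs =>
      (hγ.hasDerivWithinAt (Ioo_subset_Icc_self hs)).ambient_fst.hasDerivAt
        (Icc_mem_nhds hs.1 hs.2)
  have hcpos : 0 < (velocity γ c).1 := by
    rw [hcd]; simp only [hγ.source, hγ.target]; linarith
  have hpos : ∀ s ∈ Icc (0 : ℝ) 1, 0 < (velocity γ s).1 := by
    intro s hs
    by_contra hneg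
    obtain ⟨z, hz, hz0⟩ := isPreconnected_Icc.intermediate_value hs (Ioo_subset_Icc_self hc) hc1
      ⟨not_lt.1 hneg, hcpos.le⟩
    exact hne z hz hz0
  -- Compactness gives a uniform margin below the speed of light, which makes the final inequality
  -- strict.
  obtain ⟨z, hz, hmin⟩ := isCompact_Icc.exists_isMinOn ⟨0, h01⟩ (hc1.sub hc2)
  have hε : 0 < (velocity γ z).1 - ‖(velocity γ z).2‖ := by
    have := hlt z hz
    rw [abs_of_pos (hpos z hz)] at this
    linarith
  have := hγ.angle_le fun s hs => by
    have := hmin hs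
    simp only [mem_ofPred_eq, Pi.sub_apply] at this
    exact le_sub_comm.1 this
  linarith

/-- Null geodesics run along great circles with the speed of light. -/
lemma IsFutureNullGeodesic.exists_eq_greatCircleCurve (h : IsFutureNullGeodesic γ a b) :
    ∃ k : ℝ, 0 < k ∧ ∃ u : EuclideanSpace ℝ (Fin (d + 1)), ‖u‖ = 1 ∧ inner ℝ a.2 u = (0 : ℝ) ∧
      ∀ s ∈ Icc (0 : ℝ) 1, γ s = greatCircleCurve a u k k s := by
  have hγ := h.toIsSmoothCurve
  have h01 : (0 : ℝ) ∈ Icc (0 : ℝ) 1 := by simp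
  have hconst : ∀ F : ℝ → ℝ, (∀ s ∈ Icc (0 : ℝ) 1, HasDerivWithinAt F 0 (Icc 0 1) s) →
      ∀ s ∈ Icc (0 : ℝ) 1, F s = F 0 := fun F hF =>
    constant_of_derivWithin_zero (fun s hs => (hF s hs).differentiableWithinAt) fun s hs =>
      (hF s ⟨hs.1, hs.2.le⟩).derivWithin (uniqueDiffOn_Icc one_pos s ⟨hs.1, hs.2.le⟩)
  set k := (velocity γ 0).1 with hk
  have hkpos : 0 < k := h.future 0 h01
  have hv1 : ∀ s ∈ Icc (0 : ℝ) 1, (velocity γ s).1 = k := hconst _ fun s hs => by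
    have := (hγ.hasDerivWithinAt_velocity hs).ambient_fst
    rwa [h.geodesic s hs] at this
  have hv2 : ∀ s ∈ Icc (0 : ℝ) 1, ‖(velocity γ s).2‖ ^ 2 = k ^ 2 := fun s hs => by
    have := (h.null s hs).2
    rw [lineElement, hv1 s hs] at this
    linarith
  have hT : ∀ s ∈ Icc (0 : ℝ) 1, (γ s).1 = a.1 + k * s := fun s hs => by
    have := hconst (fun s => (γ s).1 - k * s) (fun s hs =>
      ((hγ.hasDerivWithinAt hs).ambient_fst.sub
        ((hasDerivWithinAt_id s (Icc 0 1)).const_mul k)).congr_deriv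
          (by rw [hv1 s hs, mul_one, sub_self])) s hs
    simp only [hγ.source, mul_zero, sub_zero] at this
    linarith
  have hω := harmonic_eq (f := fun s => (γ s).2) (g := fun s => (velocity γ s).2) hkpos.ne'
    (fun s hs => (hγ.hasDerivWithinAt hs).ambient_snd) fun s hs => by
      have := (hγ.hasDerivWithinAt_velocity hs).ambient_snd
      rwa [h.geodesic s hs, hv2 s hs] at this
  have hperp : inner ℝ a.2 (velocity γ 0).2 = (0 : ℝ) := by
    have hd := (hγ.hasDerivWithinAt h01).ambient_snd
    have h1 := hd.inner ℝ hd
    have h2 : HasDerivWithinAt (fun s => inner ℝ (γ s).2 (γ s).2) (0 : ℝ) (Icc 0 1) 0 :=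
      (hasDerivWithinAt_const 0 (Icc 0 1) (1 : ℝ)).congr_of_mem
        (fun s hs => inner_self_of_unit (hγ.norm_eq_one hs)) h01
    have := (uniqueDiffOn_Icc one_pos 0 h01).eq_deriv _ h1 h2
    rw [real_inner_comm (γ 0).2, hγ.source] at this
    linarith
  refine ⟨k, hkpos, k⁻¹ • (velocity γ 0).2, ?_, ?_, fun s hs => ?_⟩
  · have := (pow_left_inj₀ (norm_nonneg _) hkpos.le two_ne_zero).1 (hv2 0 h01)
    rw [norm_smul, this, norm_inv, norm_eq_abs, abs_of_pos hkpos, inv_mul_cancel₀ hkpos.ne']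
  · rw [inner_smul_right, hperp, mul_zero]
  · refine Prod.ext (hT s hs) ?_
    have := hω s hs
    simp only [hγ.source] at this
    exact this

lemma IsFutureNullGeodesic.mem_causalFuture (h : IsFutureNullGeodesic γ a b) :
    b ∈ causalFuture a :=
  ⟨h.target ▸ h.mem 1 (by simp), Or.inr ⟨γ, h.toIsSmoothCurve,
    fun s hs => ⟨(h.null s hs).1, (h.null s hs).2.ge⟩, h.future⟩⟩

/-- Points of the compactified spacetime that are timelike separated in the cylinder are joined by a
timelike curve in the compactified spacetime. -/
lemma mem_chronologicalFuture_of_angle_lt {n : EuclideanSpace ℝ (Fin (d + 1))}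
    (ha : a ∈ compactifiedMinkowski d) (hb : b ∈ compactifiedMinkowski d) (hn : ‖n‖ = 1)
    (han : inner ℝ a.2 n = (0 : ℝ)) (h : angle a.2 b.2 < b.1 - a.1) :
    b ∈ chronologicalFuture a := by
  obtain ⟨u, hu, hau, hbu⟩ := exists_greatCircle ha.1 hb.1 hn han
  set δ := angle a.2 b.2 with hδ
  have hδ0 : 0 ≤ δ := angle_nonneg _ _
  have hδπ : δ ≤ π := angle_le_pi _ _
  set k := b.1 - a.1 with hk
  have hend : greatCircleCurve a u k δ 1 = b := by
    refine Prod.ext ?_ ?_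
    · simp [greatCircleCurve, hk]
    · simp only [greatCircleCurve, mul_one]; exact hbu.symm
  have hunit (s : ℝ) : ‖(greatCircleCurve a u k δ s).2‖ = 1 := norm_greatCircle ha.1 hu hau _
  -- The lower bound on `T` is inherited from `a` and the upper one from `b`: the angle to the south
  -- pole changes by at most the angle travelled, hence by at most the elapsed time.
  have hmem : ∀ s ∈ Icc (0 : ℝ) 1, greatCircleCurve a u k δ s ∈ compactifiedMinkowski d := by
    intro s hs
    refine ⟨hunit s, ?_⟩
    rw [← angle_southPole (hunit s)]
    set w := (greatCircleCurve a u k δ s).2 with hw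
    have h1 : angle a.2 w = δ * s := by
      rw [angle_eq_arccos_inner ha.1 (hunit s)]
      have := inner_greatCircle ha.1 hu hau 0 (δ * s)
      simp only [cos_zero, sin_zero, one_smul, zero_smul, add_zero, sub_zero] at this
      rw [greatCircleCurve, this, arccos_cos (mul_nonneg hδ0 hs.1) (by nlinarith [hs.2])]
    have h2 : angle w b.2 = δ * (1 - s) := by
      rw [angle_eq_arccos_inner (hunit s) hb.1, hbu, greatCircleCurve,
        inner_greatCircle ha.1 hu hau, show δ - δ * s = δ * (1 - s) by ring,
        arccos_cos (mul_nonneg hδ0 (by linarith [hs.2])) (by nlinarith [hs.1])]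
    have hA := ha.2
    have hB := hb.2
    rw [← angle_southPole ha.1] at hA
    rw [← angle_southPole hb.1] at hB
    have t1 := angle_le_angle_add_angle a.2 w (spatialInfinity d).2
    have t2 := angle_le_angle_add_angle b.2 w (spatialInfinity d).2
    rw [angle_comm b.2 w] at t2
    have hT : (greatCircleCurve a u k δ s).1 = a.1 + k * s := rfl
    have e1 : δ * s ≤ k * s := mul_le_mul_of_nonneg_right h.le hs.1
    have e2 : δ * (1 - s) ≤ k * (1 - s) := mul_le_mul_of_nonneg_right h.le (by linarith [hs.2])
    rw [hT, abs_le]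
    constructor
    · linarith [(abs_le.1 hA).1]
    · linarith [(abs_le.1 hB).2]
  have hsm := greatCircleCurve_isSmoothCurve hmem
  rw [hend] at hsm
  refine ⟨hb, _, hsm, fun s hs => ?_, greatCircleCurve_isFutureDirected (hδ0.trans_lt h)⟩
  rw [lineElement_greatCircleCurve ha.1 hu hau hs]
  nlinarith

end Curves

/-! ### Light rays from `𝓘⁻` and the null generators of `𝓘⁺` -/

section Scri

variable {d : ℕ} {p q r : Ambient d} {γ : ℝ → Ambient d}

/-- A light ray that starts on the zero set of `ω₀ + cos T` either stays in it forever or returns to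
it only when `k * s` is a multiple of `π`. -/
lemma coord_add_cos_greatCircleCurve {a : Ambient d} (ha : a.2 0 = -cos a.1)
    (u : EuclideanSpace ℝ (Fin (d + 1))) (k s : ℝ) :
    (greatCircleCurve a u k k s).2 0 + cos (greatCircleCurve a u k k s).1 =
      sin (k * s) * (u 0 - sin a.1) := by
  simp only [greatCircleCurve, PiLp.add_apply, PiLp.smul_apply, smul_eq_mul, ha, cos_add]
  ring

/-- The end on `𝓘⁺` of the null geodesics that leave `p ∈ 𝓘⁻` into the physical spacetime: light
rays from `p` refocus at the antipodal position after the time `π`. -/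
noncomputable def refocusPoint (p : Ambient d) : Ambient d := (p.1 + π, -p.2)

lemma refocusPoint_mem_scriPlus (hp : p ∈ scriMinus d) : refocusPoint p ∈ scriPlus d := by
  obtain ⟨h1, h2, h3, h4⟩ := mem_scriMinus_iff.1 hp
  refine mem_scriPlus_iff.2 ⟨?_, ?_, ?_, ?_⟩ <;> simp only [refocusPoint]
  · rwa [norm_neg]
  · linarith
  · linarith
  · rw [cos_add_pi, PiLp.neg_apply, h4]

lemma exists_northward_scriMinus (hp : p ∈ scriMinus d) :
    ∃ u : EuclideanSpace ℝ (Fin (d + 1)), ‖u‖ = 1 ∧ inner ℝ p.2 u = (0 : ℝ) ∧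
      u 0 = -sin p.1 ∧ 0 < -sin p.1 := by
  obtain ⟨h1, h2, h3, h4⟩ := mem_scriMinus_iff.1 hp
  have hs : 0 < sin (-p.1) := sin_pos_of_pos_of_lt_pi (by linarith) (by linarith)
  obtain ⟨u, hu, hpu, hu0, -⟩ := exists_northward h1 (by rw [cos_neg, h4]) hs
  rw [sin_neg] at hs hu0
  exact ⟨u, hu, hpu, hu0, hs⟩

lemma exists_nullGeodesic_refocusPoint (hp : p ∈ scriMinus d) :
    ∃ γ : ℝ → Ambient d, IsFutureNullGeodesic γ p (refocusPoint p) ∧ EntersPhysical γ := by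
  obtain ⟨h1, h2, h3, h4⟩ := mem_scriMinus_iff.1 hp
  obtain ⟨u, hu, hpu, hu0, hs⟩ := exists_northward_scriMinus hp
  have hend : greatCircleCurve p u π π 1 = refocusPoint p := by
    simp [greatCircleCurve, refocusPoint]
  have hT : ∀ s ∈ Icc (0 : ℝ) 1, |(greatCircleCurve p u π π s).1| ≤ π := fun s hs => by
    have e1 := mul_nonneg pi_pos.le hs.1
    have e2 := mul_le_mul_of_nonneg_left hs.2 pi_pos.le
    simp only [greatCircleCurve, abs_le]
    constructor <;> linarith
  have hmem : ∀ s ∈ Icc (0 : ℝ) 1, greatCircleCurve p u π π s ∈ compactifiedMinkowski d := by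
    intro s hs'
    refine mem_compactified_iff.2 ⟨norm_greatCircle h1 hu hpu _, hT s hs', ?_⟩
    have hsin : 0 ≤ sin (π * s) := sin_nonneg_of_nonneg_of_le_pi (mul_nonneg pi_pos.le hs'.1)
      (mul_le_of_le_one_right pi_pos.le hs'.2)
    have := coord_add_cos_greatCircleCurve h4 u π s
    have : 0 ≤ sin (π * s) * (u 0 - sin p.1) := mul_nonneg hsin (by linarith)
    linarith
  have hgeo := greatCircleCurve_isFutureNullGeodesic h1 hu hpu pi_pos hmem
  rw [hend] at hgeo
  -- At half time the sine is `1` and `ω₀ + cos T` equals `-2 sin p.1 > 0`.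
  refine ⟨_, hgeo, 1 / 2, by norm_num, ?_⟩
  refine mem_physical_iff.2 ⟨norm_greatCircle h1 hu hpu _, hT _ (by norm_num), ?_⟩
  have := coord_add_cos_greatCircleCurve h4 u π (1 / 2)
  rw [mul_one_div, sin_pi_div_two, hu0] at this
  linarith

lemma avoids_spatialInfinity_iff_entersPhysical (hp : p ∈ scriMinus d) (hq : q ∈ scriPlus d)
    (hγ : IsFutureNullGeodesic γ p q) :
    (∀ s ∈ Icc (0 : ℝ) 1, γ s ≠ spatialInfinity d) ↔ EntersPhysical γ := by
  obtain ⟨h1, h2, h3, h4⟩ := mem_scriMinus_iff.1 hp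
  obtain ⟨-, g2, -, -⟩ := mem_scriPlus_iff.1 hq
  obtain ⟨k, hk, u, hu, hpu, hγu⟩ := hγ.exists_eq_greatCircleCurve
  have hend : p.1 + k = q.1 := by
    rw [← hγ.target, hγu 1 (by simp)]; simp [greatCircleCurve]
  constructor
  · intro h
    -- This is the parameter at which `T = 0`; the only point of `M̃` outside `M` at that time is
    -- `i⁰`.
    have hs : -p.1 / k ∈ Icc (0 : ℝ) 1 :=
      ⟨div_nonneg (by linarith) hk.le, (div_le_one hk).2 (by linarith)⟩
    have hT : (γ (-p.1 / k)).1 = 0 := by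
      rw [hγu _ hs]; simp only [greatCircleCurve]; field_simp; ring
    obtain ⟨m1, m2, m3⟩ := mem_compactified_iff.1 (hγ.mem _ hs)
    refine ⟨_, hs, mem_physical_iff.2 ⟨m1, m2, lt_of_le_of_ne m3 fun heq => ?_⟩⟩
    rw [hT, cos_zero] at heq
    exact h _ hs (Prod.ext hT (eq_southPole m1 heq.symm))
  · rintro ⟨s, hs, hM⟩ t ht hti
    have hMs := (mem_physical_iff.1 hM).2.2
    have es := coord_add_cos_greatCircleCurve h4 u k s
    have et := coord_add_cos_greatCircleCurve h4 u k t
    rw [← hγu s hs] at es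
    rw [← hγu t ht, hti] at et
    have hkt : k * t = -p.1 := by
      have : (γ t).1 = 0 := by rw [hti]; rfl
      rw [hγu t ht] at this
      simp only [greatCircleCurve] at this
      linarith
    have hsin : 0 < sin (-p.1) := sin_pos_of_pos_of_lt_pi (by linarith) (by linarith)
    have e0 : (spatialInfinity d).2 0 + cos (spatialInfinity d).1 = 0 := by
      simp [spatialInfinity]
    rw [e0, hkt] at et
    -- The ray reaches `i⁰` when the sine is positive, so the constant factor vanishes and the ray
    -- never leaves the zero set.
    rcases mul_eq_zero.1 et.symm with h | h
    · exact hsin.ne' h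
    · rw [h, mul_zero] at es
      linarith

lemma eq_refocusPoint_of_entersPhysical (hp : p ∈ scriMinus d) (hq : q ∈ scriPlus d)
    (hγ : IsFutureNullGeodesic γ p q) (hM : EntersPhysical γ) : q = refocusPoint p := by
  obtain ⟨h1, h2, h3, h4⟩ := mem_scriMinus_iff.1 hp
  obtain ⟨-, g2, g3, g4⟩ := mem_scriPlus_iff.1 hq
  obtain ⟨k, hk, u, hu, hpu, hγu⟩ := hγ.exists_eq_greatCircleCurve
  have hend : greatCircleCurve p u k k 1 = q := by rw [← hγ.target, hγu 1 (by simp)]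
  have hT : p.1 + k = q.1 := by rw [← hend]; simp [greatCircleCurve]
  obtain ⟨s, hs, hM⟩ := hM
  have hMs := (mem_physical_iff.1 hM).2.2
  have es := coord_add_cos_greatCircleCurve h4 u k s
  have e1 := coord_add_cos_greatCircleCurve h4 u k 1
  rw [← hγu s hs] at es
  rw [hend, g4, neg_add_cancel, mul_one] at e1
  -- Both ends lie in the zero set and the constant factor is nonzero because the ray enters `M`.
  -- Since `0 < k < 2π`, this forces `k = π`.
  have hsin : sin k = 0 := by
    rcases mul_eq_zero.1 e1.symm with h | h
    · exact h
    · rw [h, mul_zero] at es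
      linarith
  have hkπ : k = π := by
    have := (sin_eq_zero_iff_of_lt_of_lt (x := k - π) (by linarith) (by linarith)).1
      (by rw [sin_sub_pi, hsin, neg_zero])
    linarith
  rw [← hend, hkπ]
  simp [greatCircleCurve, refocusPoint]

/-- A point of `𝓘⁺` that is not timelike separated from `p` lies on the null generator of `𝓘⁺`
that leads to the refocusing point. -/
lemma mem_pastGeneratorSegment_of_le_angle (hp : p ∈ scriMinus d) (hr : r ∈ scriPlus d)
    (h : r.1 - p.1 ≤ angle p.2 r.2) : r ∈ pastGeneratorSegment (refocusPoint p) := by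
  obtain ⟨h1, h2, h3, h4⟩ := mem_scriMinus_iff.1 hp
  obtain ⟨g1, g2, g3, g4⟩ := mem_scriPlus_iff.1 hr
  have hsr : 0 < sin r.1 := sin_pos_of_pos_of_lt_pi g2 g3
  have hsp : 0 < -sin p.1 := (exists_northward_scriMinus hp).choose_spec.2.2.2
  obtain ⟨u, hu, hru, hu0, hin⟩ := exists_northward g1 g4 hsr
  have hπ : r.1 - p.1 ≤ π := h.trans (angle_le_pi _ _)
  have hcos : inner ℝ p.2 r.2 ≤ cos (r.1 - p.1) := by
    rw [← cos_angle_of_unit h1 g1]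
    exact cos_le_cos_of_nonneg_of_le_pi (by linarith) (angle_le_pi _ _) h
  -- The time left until the refocusing point; the candidate generator runs north from `r` for this
  -- long.
  set k := π - (r.1 - p.1) with hk
  have hend : greatCircleCurve r u k k 1 = refocusPoint p := by
    refine Prod.ext ?_ ?_
    · simp only [greatCircleCurve, refocusPoint, hk]; ring
    · simp only [greatCircleCurve, refocusPoint, mul_one]
      have hn := norm_greatCircle g1 hu hru k
      -- By Cauchy–Schwarz an inner product of unit vectors that is at most `-1` equals `-1`, so the
      -- curve ends at `-p.2`.
      have hle : inner ℝ p.2 (cos k • r.2 + sin k • u) ≤ -1 := by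
        have e : inner ℝ p.2 (cos k • r.2 + sin k • u) + 1 =
            (-sin p.1 / sin r.1) * (inner ℝ p.2 r.2 - cos (r.1 - p.1)) := by
          rw [inner_add_right, inner_smul_right, inner_smul_right, hin, h4, hk, cos_pi_sub,
            sin_pi_sub, cos_sub, sin_sub]
          field_simp
          have hp2 := sin_sq_add_cos_sq p.1
          have hr2 := sin_sq_add_cos_sq r.1
          grind
        have : (-sin p.1 / sin r.1) * (inner ℝ p.2 r.2 - cos (r.1 - p.1)) ≤ 0 :=
          mul_nonpos_of_nonneg_of_nonpos (div_pos hsp hsr).le (by linarith)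
        linarith
      have hge := neg_le_of_abs_le (abs_real_inner_le_norm p.2 (cos k • r.2 + sin k • u))
      rw [h1, hn, mul_one] at hge
      symm
      refine (inner_eq_one_iff_of_norm_eq_one (𝕜 := ℝ) (by rwa [norm_neg]) hn).1 ?_
      rw [inner_neg_left]
      linarith
  rcases (show 0 ≤ k by linarith).eq_or_lt with hk0 | hkpos
  · left
    rw [← hend, ← hk0]
    simp [greatCircleCurve]
  · right
    have hscri : ∀ s ∈ Icc (0 : ℝ) 1, greatCircleCurve r u k k s ∈ scriPlus d := by
      intro s hs
      have e1 := mul_nonneg hkpos.le hs.1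
      have e2 := mul_le_mul_of_nonneg_left hs.2 hkpos.le
      refine mem_scriPlus_iff.2 ⟨norm_greatCircle g1 hu hru _, ?_, ?_, ?_⟩
      · simp only [greatCircleCurve]; linarith
      · simp only [greatCircleCurve]; linarith
      -- For the northward direction the constant factor is zero, so the ray stays in `𝓘⁺`.
      · have := coord_add_cos_greatCircleCurve g4 u k s
        rw [hu0, sub_self, mul_zero] at this
        linarith
    have hgeo := greatCircleCurve_isFutureNullGeodesic g1 hu hru hkpos
      fun s hs => scriPlus_subset d (hscri s hs)
    rw [hend] at hgeo
    exact ⟨_, hgeo, hscri⟩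

/-- Angle and elapsed time from `r` to the refocusing point are the complements to `π` of those
between `p` and `r`, so the causal inequality reverses. -/
lemma le_angle_of_mem_causalPast (hr : ‖r.2‖ = 1) (h : r ∈ causalPast (refocusPoint p)) :
    r.1 - p.1 ≤ angle p.2 r.2 := by
  have := angle_le_of_mem_causalFuture hr h.2
  simp only [refocusPoint, angle_neg_right] at this
  rw [angle_comm]
  linarith

lemma mem_causalPast_of_null (hr : r ∈ compactifiedMinkowski d)
    (h : r = q ∨ ∃ γ : ℝ → Ambient d, IsFutureNullGeodesic γ r q) : r ∈ causalPast q := by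
  refine ⟨hr, ?_⟩
  rcases h with rfl | ⟨γ, hγ⟩
  · exact ⟨hr, Or.inl rfl⟩
  · exact hγ.mem_causalFuture

lemma pastGeneratorSegment_subset (hq : q ∈ scriPlus d) : pastGeneratorSegment q ⊆
    {r | r ∈ scriPlus d ∧ (r = q ∨ ∃ γ : ℝ → Ambient d, IsFutureNullGeodesic γ r q)} := by
  rintro r (rfl | ⟨γ, hγ, hs⟩)
  · exact ⟨hq, Or.inl rfl⟩
  · exact ⟨hγ.source ▸ hs 0 (by simp), Or.inr ⟨γ, hγ⟩⟩

/-- Slightly earlier points at the same position are at angle `π` from `p` but less than `π` later,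
so they lie outside the causal future and converge to the refocusing point. -/
lemma refocusPoint_mem_boundary (hp : p ∈ scriMinus d) :
    refocusPoint p ∈ boundaryInCompactified (causalFuture p) := by
  have hq := refocusPoint_mem_scriPlus hp
  have hqM := scriPlus_subset d hq
  obtain ⟨γ, hγ, -⟩ := exists_nullGeodesic_refocusPoint hp
  obtain ⟨-, g2, g3, -⟩ := mem_scriPlus_iff.1 hq
  refine ⟨⟨_, hqM⟩, ⟨subset_closure hγ.mem_causalFuture, fun hint => ?_⟩, rfl⟩
  set T := (refocusPoint p).1 with hT
  have hmem (t : ℝ) (ht : t ∈ Icc 0 T) :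
      ((t, (refocusPoint p).2) : Ambient d) ∈ compactifiedMinkowski d := by
    refine ⟨hqM.1, ?_⟩
    rw [abs_of_nonneg ht.1]
    exact ht.2.trans ((le_abs_self _).trans hqM.2)
  let c : Icc 0 T → compactifiedMinkowski d := fun t => ⟨(t, (refocusPoint p).2), hmem t t.2⟩
  have hc : Continuous c := by
    refine Continuous.subtype_mk ?_ _
    fun_prop
  have hTI : T ∈ Icc 0 T := ⟨g2.le, le_rfl⟩
  have hopen : c ⁻¹' interior (Subtype.val ⁻¹' causalFuture p) ∈ 𝓝 (⟨T, hTI⟩ : Icc 0 T) :=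
    (isOpen_interior.preimage hc).mem_nhds hint
  rw [nhds_subtype_eq_comap, mem_comap] at hopen
  obtain ⟨U, hU, hUs⟩ := hopen
  have h1 : ∀ᶠ t in 𝓝[<] T, t ∈ U ∧ t ∈ Icc 0 T ∧ t < T := by
    filter_upwards [mem_nhdsWithin_of_mem_nhds hU, Icc_mem_nhdsLT g2, self_mem_nhdsWithin]
      with t a b c using ⟨a, b, c⟩
  obtain ⟨t, htU, htI, htT⟩ := h1.exists
  have hJ' : c ⟨t, htI⟩ ∈ (Subtype.val ⁻¹' causalFuture p : Set (compactifiedMinkowski d)) :=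
    interior_subset (hUs (show (⟨t, htI⟩ : Icc 0 T) ∈ Subtype.val ⁻¹' U from htU))
  have hJ : ((t, (refocusPoint p).2) : Ambient d) ∈ causalFuture p := hJ'
  have := angle_le_of_mem_causalFuture hp.1 hJ
  have hp0 : p.2 ≠ 0 := fun h0 => by simpa [h0] using hp.1
  simp only [refocusPoint, angle_neg_right, angle_self hp0] at this hT
  linarith

end Scri

/-! ### Assembly of the theorem -/

theorem proposition3p3 (d : ℕ) (hd : 1 ≤ d) (p : Ambient d) (hp : p ∈ scriMinus d) :
    (∃! q : Ambient d, q ∈ scriPlus d ∧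
      ∃ γ : ℝ → Ambient d, IsFutureNullGeodesic γ p q ∧ EntersPhysical γ) ∧
    (∀ q ∈ scriPlus d, ∀ γ : ℝ → Ambient d, IsFutureNullGeodesic γ p q →
      ((∀ s ∈ Set.Icc (0 : ℝ) 1, γ s ≠ spatialInfinity d) ↔ EntersPhysical γ)) ∧
    ∀ q ∈ scriPlus d,
      (∃ γ : ℝ → Ambient d, IsFutureNullGeodesic γ p q ∧ EntersPhysical γ) →
        q ∈ boundaryInCompactified (causalFuture p) ∧
        chronologicalFuture p ∩ scriPlus d = scriPlus d \ (causalPast q ∩ scriPlus d) ∧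
        {r | r ∈ scriPlus d ∧ ¬ TimelikeConnected p r} =
          {r | r ∈ scriPlus d ∧
            (r = q ∨ ∃ γ : ℝ → Ambient d, IsFutureNullGeodesic γ r q)} ∧
        {r | r ∈ scriPlus d ∧ ¬ TimelikeConnected p r} = pastGeneratorSegment q := by
  refine ⟨⟨refocusPoint p, ⟨refocusPoint_mem_scriPlus hp, exists_nullGeodesic_refocusPoint hp⟩,
    fun q ⟨hq, γ, hγ, hM⟩ => eq_refocusPoint_of_entersPhysical hp hq hγ hM⟩,
    fun q hq γ hγ => avoids_spatialInfinity_iff_entersPhysical hp hq hγ, ?_⟩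
  rintro q hq ⟨γ, hγ, hM⟩
  obtain rfl := eq_refocusPoint_of_entersPhysical hp hq hγ hM
  have hpT := (mem_scriMinus_iff.1 hp).2.2.1
  have hchron : ∀ r ∈ scriPlus d, angle p.2 r.2 < r.1 - p.1 → r ∈ chronologicalFuture p := by
    intro r hr h
    obtain ⟨n, hn, hpn, -⟩ := exists_northward_scriMinus hp
    exact mem_chronologicalFuture_of_angle_lt (scriMinus_subset d hp) (scriPlus_subset d hr) hn
      hpn h
  -- `TimelikeConnected` leaves the time direction open; `p.1 < 0 < r.1` settles it.
  have hconn : ∀ r ∈ scriPlus d, TimelikeConnected p r → angle p.2 r.2 < r.1 - p.1 :=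
    fun r hr h =>
      angle_lt_of_timelikeConnected (hpT.trans (mem_scriPlus_iff.1 hr).2.1) h
  have hgen : ∀ r, r ∈ scriPlus d ∧ ¬ TimelikeConnected p r →
      r ∈ pastGeneratorSegment (refocusPoint p) := fun r ⟨hr, h⟩ => by
    refine mem_pastGeneratorSegment_of_le_angle hp hr (not_lt.1 fun hlt => h ?_)
    obtain ⟨-, γ, h1, h2, -⟩ := hchron r hr hlt
    exact ⟨γ, h1, h2⟩
  have hnull : ∀ r, r ∈ scriPlus d ∧ (r = refocusPoint p ∨ ∃ γ : ℝ → Ambient d,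
      IsFutureNullGeodesic γ r (refocusPoint p)) → r ∈ scriPlus d ∧ ¬ TimelikeConnected p r :=
    fun r ⟨hr, h⟩ => ⟨hr, fun hc => (hconn r hr hc).not_ge (le_angle_of_mem_causalPast hr.1
      (mem_causalPast_of_null (scriPlus_subset d hr) h))⟩
  -- With `hgen` and `hnull` this closes a cycle of inclusions, so the three descriptions of the
  -- unreachable points agree.
  have hsub := pastGeneratorSegment_subset hq
  refine ⟨refocusPoint_mem_boundary hp, ?_, ?_, ?_⟩
  · ext r
    constructor
    · rintro ⟨⟨-, γ, h1, h2, -⟩, hr⟩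
      exact ⟨hr, fun hJ => (hconn r hr ⟨γ, h1, h2⟩).not_ge (le_angle_of_mem_causalPast hr.1 hJ.1)⟩
    · rintro ⟨hr, hJ⟩
      refine ⟨hchron r hr (not_le.1 fun hle => hJ ⟨?_, hr⟩), hr⟩
      exact mem_causalPast_of_null (scriPlus_subset d hr)
        (hsub (mem_pastGeneratorSegment_of_le_angle hp hr hle)).2
  · exact Subset.antisymm (fun r h => hsub (hgen r h)) hnull
  · exact Subset.antisymm hgen fun r h => hnull r (hsub h)
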